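/- Let $d\ge 2$ be an integer and let $U$ be a random matrix distributed according to the Haar probability measure on the group $\mathbb U(d)$ of complex unitary $d\times d$ matrices. Let $a\in\mathbb C^d$ be any fixed column of $U$, and let $a^{\mathsf T}a=\sum_{k=1}^d a_k^2$ (no complex conjugation). Then $$|a^{\mathsf T}a|^2\sim \mathrm{Beta}\Bigl(1,\frac{d-1}{2}\Bigr),$$ where $\mathrm{Beta}(\alpha,\beta)$, for $\alpha,\beta>0$, is the probability distribution on $\mathbb R$ with density $\frac{\Gamma(\alpha+\beta)}{\Gamma(\alpha)\Gamma(\beta)}\,x^{\alpha-1}(1-x)^{\beta-1}$ on $(0,1)$ and $0$ elsewhere. -/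

import Mathlib

open MeasureTheory ProbabilityTheory

namespace HaarUnitary

/-- The group `U(d)` of complex unitary `d × d` matrices, with the topology inherited from
the space of all matrices. -/
abbrev UGroup (d : ℕ) : Type := Matrix.unitaryGroup (Fin d) ℂ

/-- The Borel σ-algebra on `U(d)`. -/
noncomputable instance instMeasurableSpaceUGroup (d : ℕ) : MeasurableSpace (UGroup d) := borel _

instance instBorelSpaceUGroup (d : ℕ) : BorelSpace (UGroup d) := ⟨rfl⟩

/-- `U(d)` is compact: it is closed, and its entries are bounded by `1`. -/
instance instCompactSpaceUGroup (d : ℕ) : CompactSpace (UGroup d) := by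
  refine isCompact_iff_compactSpace.mp ?_
  have hK : IsCompact {A : Matrix (Fin d) (Fin d) ℂ |
      ∀ i, A i ∈ {v : Fin d → ℂ | ∀ j, v j ∈ Metric.closedBall (0 : ℂ) 1}} :=
    isCompact_pi_infinite fun _ => isCompact_pi_infinite fun _ => isCompact_closedBall _ _
  refine hK.of_isClosed_subset ?_ ?_
  · have hset : (Matrix.unitaryGroup (Fin d) ℂ : Set (Matrix (Fin d) (Fin d) ℂ))
        = {A | A * star A = 1} := by
      ext A
      exact Matrix.mem_unitaryGroup_iff
    rw [hset]
    exact isClosed_eq (continuous_id.mul continuous_star) continuous_const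
  · intro A hA i j
    simpa using entry_norm_bound_of_unitary hA i j

/-- The Haar probability measure on `U(d)`: the left-invariant measure giving the whole
(compact) group mass `1`. -/
noncomputable def unitaryHaar (d : ℕ) : Measure (UGroup d) :=
  Measure.haarMeasure ⊤

instance instIsHaarMeasureUnitaryHaar (d : ℕ) : (unitaryHaar d).IsHaarMeasure :=
  Measure.isHaarMeasure_haarMeasure _

instance instIsProbabilityMeasureUnitaryHaar (d : ℕ) : IsProbabilityMeasure (unitaryHaar d) :=
  ⟨by simpa [unitaryHaar] using Measure.haarMeasure_self (G := UGroup d) (K₀ := ⊤)⟩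

end HaarUnitary

/-! ### Gaussian integrals of a Gram determinant -/

namespace HaarUnitary

open Real Set

/-! The law is identified through the moments of `1 - |aᵀ a|²`. For `z = x + i y` in `ℂ^d`, the
quantity `|z|⁴ - |zᵀ z|²` is homogeneous of degree 4 and equals four times the Gram determinant of
`x` and `y`. Integrate its `k`-th power against `exp (-|z|²)` in two ways.

The weight is unitarily invariant, so averaging over Haar measure splits the integral into a radial
moment times the required Haar moment (`lintegral_momentWeight`). Directly, for fixed `x` the Gram
determinant is `|x|²` times the squared distance from `y` to the line through `x` when `x ≠ 0`, so
everything reduces to radial Gaussian moments (`lintegral_lintegral_gram_pow`).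

With `m = (d - 1) / 2`, the duplication formula turns the quotient into `m / (m + k)`
(`gamma_ratio_eq`). These are the moments of `1 - x` under `Beta(1, m)`, and by Weierstrass
approximation they determine a law on `[0, 1]`. -/

/-- The radial moments of the unnormalised Gaussian weight `exp (-‖x‖ ^ 2)`. -/
theorem lintegral_norm_pow_mul_exp_neg_norm_sq {E : Type*} [NormedAddCommGroup E]
    [InnerProductSpace ℝ E] [FiniteDimensional ℝ E] [MeasurableSpace E] [BorelSpace E]
    [Nontrivial E] (k : ℕ) :
    ∫⁻ x : E, ENNReal.ofReal (‖x‖ ^ (2 * k) * exp (-‖x‖ ^ 2)) =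
      ENNReal.ofReal (√π ^ Module.finrank ℝ E / Gamma (Module.finrank ℝ E / 2) *
        Gamma (Module.finrank ℝ E / 2 + k)) := by
  set n := Module.finrank ℝ E with hn
  have hn0 : 0 < n := Module.finrank_pos
  have hn1 : (1 : ℝ) ≤ n := by exact_mod_cast hn0
  have hk0 : (0 : ℝ) ≤ k := k.cast_nonneg
  have key : ∀ y ∈ Ioi (0 : ℝ), y ^ (n - 1) • (y ^ (2 * k) * exp (-y ^ 2)) =
      y ^ ((n : ℝ) - 1 + 2 * k) * exp (-y ^ (2 : ℝ)) := by
    intro y hy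
    have : ((n : ℝ) - 1 + 2 * k) = ((n - 1 + 2 * k : ℕ) : ℝ) := by
      push_cast [Nat.cast_sub hn0]; ring
    rw [this, rpow_natCast, pow_add, smul_eq_mul, mul_assoc]
    norm_cast
  have hint : Integrable (fun x : E => ‖x‖ ^ (2 * k) * exp (-‖x‖ ^ 2)) := by
    refine (integrable_fun_norm_addHaar (volume : Measure E)
      (f := fun y : ℝ => y ^ (2 * k) * exp (-y ^ 2))).2 ?_
    rw [integrableOn_congr_fun key measurableSet_Ioi]
    exact integrableOn_rpow_mul_exp_neg_rpow (by linarith) (by norm_num)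
  rw [← ofReal_integral_eq_lintegral_ofReal hint (.of_forall fun x => by positivity),
    integral_fun_norm_addHaar (volume : Measure E) (fun y : ℝ => y ^ (2 * k) * exp (-y ^ 2)),
    setIntegral_congr_fun measurableSet_Ioi key,
    integral_rpow_mul_exp_neg_rpow (by norm_num) (by linarith), measureReal_def,
    InnerProductSpace.volume_ball, ← hn]
  have hG : Gamma ((n : ℝ) / 2 + 1) = n / 2 * Gamma (n / 2) := Gamma_add_one (by positivity)
  have hGp : 0 < Gamma ((n : ℝ) / 2) := Gamma_pos_of_pos (by positivity)
  have e : ((n : ℝ) - 1 + 2 * k + 1) / 2 = n / 2 + k := by ring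
  rw [hG, e]
  congr 1
  simp only [ENNReal.ofReal_one, one_pow, one_mul, nsmul_eq_mul, smul_eq_mul]
  rw [ENNReal.toReal_ofReal (by positivity)]
  field_simp

/-- Integrating out one coordinate: in dimension `n + 1`, the squared distance of a Gaussian
vector to a coordinate axis is distributed as a squared norm in dimension `n`. -/
theorem lintegral_norm_sq_sub_coord_sq {n : ℕ} [NeZero n] (k : ℕ) :
    ∫⁻ y : EuclideanSpace ℝ (Fin (n + 1)),
        ENNReal.ofReal ((‖y‖ ^ 2 - y 0 ^ 2) ^ k * exp (-‖y‖ ^ 2)) =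
      ENNReal.ofReal (√π ^ (n + 1) / Gamma (n / 2) * Gamma (n / 2 + k)) := by
  have : Nontrivial (EuclideanSpace ℝ (Fin n)) := by
    have : Nonempty (Fin n) := ⟨0⟩
    infer_instance
  have h1 := (PiLp.volume_preserving_toLp (Fin (n + 1)))
  have h2 := (volume_preserving_piFinSuccAbove (fun _ : Fin (n + 1) => ℝ) 0).symm
  have h3 := (PiLp.volume_preserving_ofLp (Fin n))
  rw [← h1.lintegral_comp_emb (MeasurableEquiv.toLp 2 (Fin (n+1) → ℝ)).measurableEmbedding,
    ← h2.lintegral_comp_emb (MeasurableEquiv.measurableEmbedding _), Measure.volume_eq_prod,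
    lintegral_prod _ (by fun_prop)]
  have : ∀ (t : ℝ) (w : Fin n → ℝ), ENNReal.ofReal
      ((‖WithLp.toLp 2 ((MeasurableEquiv.piFinSuccAbove (fun _ : Fin (n + 1) => ℝ) 0).symm
        (t, w))‖ ^ 2 - (WithLp.toLp 2 ((MeasurableEquiv.piFinSuccAbove
          (fun _ : Fin (n + 1) => ℝ) 0).symm (t, w))) 0 ^ 2) ^ k *
        exp (-‖WithLp.toLp 2 ((MeasurableEquiv.piFinSuccAbove (fun _ : Fin (n + 1) => ℝ) 0).symm
        (t, w))‖ ^ 2)) = ENNReal.ofReal (exp (-1 * t ^ 2)) *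
        ENNReal.ofReal (‖WithLp.toLp 2 w‖ ^ (2 * k) * exp (-‖WithLp.toLp 2 w‖ ^ 2)) := by
    intro t w
    rw [← ENNReal.ofReal_mul (exp_pos _).le, pow_mul]
    simp only [EuclideanSpace.norm_sq_eq, MeasurableEquiv.piFinSuccAbove_symm_apply,
      Fin.sum_univ_succ, Fin.insertNthEquiv_zero, Fin.consEquiv_apply, Fin.cons_zero,
      Fin.cons_succ, norm_eq_abs, sq_abs, add_sub_cancel_left, neg_add, exp_add, neg_mul, one_mul]
    congr 1
    ring
  simp_rw [this]
  have h4 : ∫⁻ w : Fin n → ℝ, ENNReal.ofReal (‖WithLp.toLp 2 w‖ ^ (2 * k) *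
      exp (-‖WithLp.toLp 2 w‖ ^ 2)) =
      ENNReal.ofReal (√π ^ n / Gamma (n / 2) * Gamma (n / 2 + k)) := by
    rw [(PiLp.volume_preserving_toLp (Fin n)).lintegral_comp_emb
      (MeasurableEquiv.toLp 2 (Fin n → ℝ)).measurableEmbedding
      (fun y : EuclideanSpace ℝ (Fin n) => ENNReal.ofReal (‖y‖ ^ (2 * k) * exp (-‖y‖ ^ 2))),
      lintegral_norm_pow_mul_exp_neg_norm_sq]
    simp
  have h5 : ∫⁻ t : ℝ, ENNReal.ofReal (exp (-1 * t ^ 2)) = ENNReal.ofReal √π := by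
    rw [← ofReal_integral_eq_lintegral_ofReal (integrable_exp_neg_mul_sq one_pos)
      (.of_forall fun _ => (exp_pos _).le), integral_gaussian, div_one]
  simp_rw [lintegral_const_mul' _ _ ENNReal.ofReal_ne_top, h4]
  rw [lintegral_mul_const' _ _ ENNReal.ofReal_ne_top, h5, ← ENNReal.ofReal_mul (by positivity)]
  congr 1
  ring

/-- A reflection carries `x` to `‖x‖ e₀` and preserves the Gaussian weight; the Gram determinant
becomes `‖x‖² (‖y‖² - y₀²)`. -/
theorem lintegral_gram_pow {n : ℕ} [NeZero n] (k : ℕ) (x : EuclideanSpace ℝ (Fin (n + 1))) :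
    ∫⁻ y : EuclideanSpace ℝ (Fin (n + 1)),
        ENNReal.ofReal ((‖x‖ ^ 2 * ‖y‖ ^ 2 - inner ℝ x y ^ 2) ^ k * exp (-‖y‖ ^ 2)) =
      ENNReal.ofReal (‖x‖ ^ (2 * k)) *
        ENNReal.ofReal (√π ^ (n + 1) / Gamma (n / 2) * Gamma (n / 2 + k)) := by
  set w : EuclideanSpace ℝ (Fin (n + 1)) := EuclideanSpace.single 0 ‖x‖ with hw
  have hxw : ‖x‖ = ‖w‖ := by simp [hw]
  set R := (ℝ ∙ (x - w))ᗮ.reflection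
  have hR : R x = w := Submodule.reflection_sub hxw
  symm
  rw [← lintegral_norm_sq_sub_coord_sq, ← lintegral_const_mul' _ _ ENNReal.ofReal_ne_top,
    ← (LinearIsometryEquiv.measurePreserving R).lintegral_comp_emb
      R.toMeasurableEquiv.measurableEmbedding]
  refine lintegral_congr fun y => ?_
  have h : inner ℝ x y = ‖x‖ * R y 0 := by
    rw [← R.inner_map_map, hR, hw, EuclideanSpace.inner_single_left]
    simp
  rw [← ENNReal.ofReal_mul (by positivity), h, R.norm_map, pow_mul, ← mul_assoc, ← mul_pow]
  congr 3
  ring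

theorem lintegral_lintegral_gram_pow {n : ℕ} [NeZero n] (k : ℕ) :
    ∫⁻ x : EuclideanSpace ℝ (Fin (n + 1)), ∫⁻ y : EuclideanSpace ℝ (Fin (n + 1)),
        ENNReal.ofReal ((4 * (‖x‖ ^ 2 * ‖y‖ ^ 2 - inner ℝ x y ^ 2)) ^ k *
          exp (-(‖x‖ ^ 2 + ‖y‖ ^ 2))) =
      ENNReal.ofReal (4 ^ k * (√π ^ (n + 1) / Gamma ((n + 1) / 2) * Gamma ((n + 1) / 2 + k)) *
        (√π ^ (n + 1) / Gamma (n / 2) * Gamma (n / 2 + k))) := by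
  have hn : (0 : ℝ) < n := by exact_mod_cast NeZero.pos n
  have hg : 0 < Gamma (n / 2 : ℝ) := Gamma_pos_of_pos (by positivity)
  have hgk : 0 < Gamma (n / 2 + k : ℝ) := Gamma_pos_of_pos (by positivity)
  have hg' : 0 < Gamma ((n + 1) / 2 : ℝ) := Gamma_pos_of_pos (by positivity)
  have hgk' : 0 < Gamma ((n + 1) / 2 + k : ℝ) := Gamma_pos_of_pos (by positivity)
  have h (x : EuclideanSpace ℝ (Fin (n + 1))) : ∫⁻ y : EuclideanSpace ℝ (Fin (n + 1)),
        ENNReal.ofReal ((4 * (‖x‖ ^ 2 * ‖y‖ ^ 2 - inner ℝ x y ^ 2)) ^ k *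
          exp (-(‖x‖ ^ 2 + ‖y‖ ^ 2))) =
      ENNReal.ofReal (‖x‖ ^ (2 * k) * exp (-‖x‖ ^ 2)) *
        ENNReal.ofReal (4 ^ k * (√π ^ (n + 1) / Gamma (n / 2) * Gamma (n / 2 + k))) := by
    have e := congrArg (ENNReal.ofReal (4 ^ k * exp (-‖x‖ ^ 2)) * ·) (lintegral_gram_pow k x)
    rw [← lintegral_const_mul' _ _ ENNReal.ofReal_ne_top] at e
    convert! e using 1
    · refine lintegral_congr fun y => ?_
      rw [← ENNReal.ofReal_mul (by positivity), neg_add, exp_add, mul_pow]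
      congr 1
      ring
    · rw [← ENNReal.ofReal_mul (by positivity), ← ENNReal.ofReal_mul (by positivity),
        ← ENNReal.ofReal_mul (by positivity)]
      congr 1
      ring
  simp_rw [h]
  rw [lintegral_mul_const' _ _ ENNReal.ofReal_ne_top, lintegral_norm_pow_mul_exp_neg_norm_sq,
    ← ENNReal.ofReal_mul]
  · simp only [finrank_euclideanSpace, Fintype.card_fin, Nat.cast_add, Nat.cast_one]
    congr 1
    ring
  · simp only [finrank_euclideanSpace, Fintype.card_fin, Nat.cast_add, Nat.cast_one]
    positivity

end HaarUnitary

/-! ### Unitary averaging of the Gaussian weight -/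

namespace HaarUnitary

open Real Matrix

/-- A right translate of the Haar probability measure is again one, and such a measure is unique. -/
instance instIsMulRightInvariantUnitaryHaar (d : ℕ) : (unitaryHaar d).IsMulRightInvariant where
  map_mul_right_eq_self g := by
    have : IsProbabilityMeasure ((unitaryHaar d).map (· * g)) :=
      Measure.isProbabilityMeasure_map (by fun_prop)
    exact Measure.isHaarMeasure_eq_of_isProbabilityMeasure _ _

/-- The squared Euclidean norm of a complex vector. -/
noncomputable def normSqVec {d : ℕ} (z : Fin d → ℂ) : ℝ := ∑ i, ‖z i‖ ^ 2

theorem ofReal_normSqVec {d : ℕ} (z : Fin d → ℂ) : (normSqVec z : ℂ) = star z ⬝ᵥ z := by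
  simp [normSqVec, dotProduct, Complex.conj_mul']

theorem normSqVec_mulVec {d : ℕ} (W : UGroup d) (z : Fin d → ℂ) :
    normSqVec ((W : Matrix (Fin d) (Fin d) ℂ) *ᵥ z) = normSqVec z := by
  apply Complex.ofReal_injective
  rw [ofReal_normSqVec, ofReal_normSqVec, star_mulVec, dotProduct_mulVec, vecMul_vecMul,
    ← star_eq_conjTranspose, UnitaryGroup.star_mul_self, vecMul_one]

theorem normSqVec_col {d : ℕ} (W : UGroup d) (j : Fin d) :
    normSqVec ((W : Matrix (Fin d) (Fin d) ℂ).col j) = 1 := by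
  rw [← mulVec_single_one, normSqVec_mulVec, normSqVec]
  simp [Pi.single_apply, apply_ite]

/-- Every complex vector is a nonnegative multiple of the `j`-th column of some unitary matrix. -/
theorem exists_unitary_col {d : ℕ} (j : Fin d) (z : Fin d → ℂ) :
    ∃ V : UGroup d, z = ((√(normSqVec z) : ℝ) : ℂ) • (V : Matrix (Fin d) (Fin d) ℂ).col j := by
  have hN : normSqVec z = ‖WithLp.toLp 2 z‖ ^ 2 := by
    rw [EuclideanSpace.norm_sq_eq]; rfl
  rw [hN, sqrt_sq (norm_nonneg _)]
  by_cases hz : z = 0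
  · exact ⟨1, by simp [hz]⟩
  set u : EuclideanSpace ℂ (Fin d) := WithLp.toLp 2 z with hu
  have hu0 : ‖u‖ ≠ 0 := by simpa [hu] using hz
  -- Indexing the single unit vector by `{j}` forces the extended basis to have it in position `j`.
  have hon : Orthonormal ℂ (({j} : Set (Fin d)).domRestrict
      (fun _ => ((‖u‖⁻¹ : ℝ) : ℂ) • u)) := by
    refine ⟨fun i => ?_, fun i k hik => (hik (Subsingleton.elim i k)).elim⟩
    simp [Set.domRestrict, norm_smul, hu0]
  obtain ⟨b, hb⟩ := hon.exists_orthonormalBasis_extension_of_card_eq (by simp)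
  refine ⟨⟨_, (EuclideanSpace.basisFun (Fin d) ℂ).toMatrix_orthonormalBasis_mem_unitary b⟩, ?_⟩
  ext i
  have := congrArg (fun w : EuclideanSpace ℂ (Fin d) => w i) (hb j rfl)
  simp only [PiLp.smul_apply, smul_eq_mul, hu] at this
  simp only [Pi.smul_apply, col_apply, Module.Basis.toMatrix_apply, smul_eq_mul,
    OrthonormalBasis.coe_toBasis_repr_apply, EuclideanSpace.basisFun_repr, this]
  rw [← mul_assoc, ← Complex.ofReal_mul, mul_inv_cancel₀ hu0, Complex.ofReal_one, one_mul]

/-- `ℝ^d × ℝ^d` with its Euclidean structure, the underlying real space of `ℂ^d`. -/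
abbrev RealPair (d : ℕ) : Type :=
  WithLp 2 (EuclideanSpace ℝ (Fin d) × EuclideanSpace ℝ (Fin d))

/-- The identification `(x, y) ↦ x + i y` of `ℝ^d × ℝ^d` with `ℂ^d`. -/
noncomputable def toComplexVec (d : ℕ) : RealPair d ≃ₗ[ℝ] (Fin d → ℂ) where
  toFun g i := ⟨g.fst i, g.snd i⟩
  map_add' g h := by ext i; simp [Complex.ext_iff]
  map_smul' c g := by ext i; simp [Complex.ext_iff]
  invFun z := WithLp.toLp 2 (WithLp.toLp 2 fun i => (z i).re, WithLp.toLp 2 fun i => (z i).im)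
  left_inv g := rfl
  right_inv z := rfl

theorem toComplexVec_apply {d : ℕ} (g : RealPair d) (i : Fin d) :
    toComplexVec d g i = ⟨g.fst i, g.snd i⟩ := rfl

theorem continuous_toComplexVec (d : ℕ) : Continuous fun g : RealPair d => toComplexVec d g := by
  refine continuous_pi fun i => ?_
  have : Continuous fun g : RealPair d => ((g.fst i : ℂ) + g.snd i * Complex.I) := by
    have h1 : Continuous fun g : RealPair d => g.fst := WithLp.continuous_fst ..
    have h2 : Continuous fun g : RealPair d => g.snd := WithLp.continuous_snd ..
    fun_prop
  refine this.congr fun g => ?_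
  rw [toComplexVec_apply, Complex.mk_eq_add_mul_I]

theorem normSqVec_toComplexVec {d : ℕ} (g : RealPair d) :
    normSqVec (toComplexVec d g) = ‖g.fst‖ ^ 2 + ‖g.snd‖ ^ 2 := by
  simp only [normSqVec, EuclideanSpace.norm_sq_eq, ← Finset.sum_add_distrib, toComplexVec_apply,
    Complex.sq_norm, Complex.normSq_mk, norm_eq_abs, sq_abs, ← sq]

theorem normSqVec_toComplexVec_eq_norm_sq {d : ℕ} (g : RealPair d) :
    normSqVec (toComplexVec d g) = ‖g‖ ^ 2 := by
  rw [normSqVec_toComplexVec, WithLp.prod_norm_sq_eq_of_L2]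

/-- Since `zᵀ z = (‖x‖² - ‖y‖²) + 2 i ⟨x, y⟩`, this is `(A + B)² - (A - B)² = 4 A B` with `A = ‖x‖²`
and `B = ‖y‖²`. -/
theorem norm_dotProduct_toComplexVec_sq {d : ℕ} (g : RealPair d) :
    normSqVec (toComplexVec d g) ^ 2 - ‖toComplexVec d g ⬝ᵥ toComplexVec d g‖ ^ 2 =
      4 * (‖g.fst‖ ^ 2 * ‖g.snd‖ ^ 2 - inner ℝ g.fst g.snd ^ 2) := by
  have h : toComplexVec d g ⬝ᵥ toComplexVec d g =
      ⟨‖g.fst‖ ^ 2 - ‖g.snd‖ ^ 2, 2 * inner ℝ g.fst g.snd⟩ := by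
    apply Complex.ext
    · simp only [dotProduct, Complex.re_sum, toComplexVec_apply, EuclideanSpace.norm_sq_eq,
        Complex.mul_re, Finset.sum_sub_distrib, norm_eq_abs, sq_abs]
      simp only [sq]
    · simp only [dotProduct, Complex.im_sum, toComplexVec_apply, PiLp.inner_apply, Complex.mul_im,
        Finset.mul_sum, RCLike.inner_apply, conj_trivial]
      exact Finset.sum_congr rfl fun i _ => by ring
  rw [h, normSqVec_toComplexVec, Complex.sq_norm, Complex.normSq_mk]
  ring

/-- The action of a unitary matrix on `ℝ^d × ℝ^d`, as a real linear isometry. -/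
noncomputable def unitaryAct {d : ℕ} (W : UGroup d) : RealPair d ≃ₗᵢ[ℝ] RealPair d :=
  LinearIsometry.toLinearIsometryEquiv
    { toLinearMap := (toComplexVec d).symm.toLinearMap ∘ₗ
        ((W : Matrix (Fin d) (Fin d) ℂ).mulVecLin.restrictScalars ℝ) ∘ₗ
        (toComplexVec d).toLinearMap
      norm_map' := fun g => by
        rw [← sq_eq_sq₀ (norm_nonneg _) (norm_nonneg _), ← normSqVec_toComplexVec_eq_norm_sq,
          ← normSqVec_toComplexVec_eq_norm_sq]
        simp [normSqVec_mulVec] } rfl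

theorem toComplexVec_unitaryAct {d : ℕ} (W : UGroup d) (g : RealPair d) :
    toComplexVec d (unitaryAct W g) = (W : Matrix (Fin d) (Fin d) ℂ) *ᵥ toComplexVec d g := by
  simp [unitaryAct]

theorem norm_dotProduct_col_sq_le_one {d : ℕ} (W : UGroup d) (j : Fin d) :
    ‖(W : Matrix (Fin d) (Fin d) ℂ).col j ⬝ᵥ (W : Matrix (Fin d) (Fin d) ℂ).col j‖ ^ 2 ≤ 1 := by
  rw [sq_le_one_iff₀ (norm_nonneg _), ← normSqVec_col W j]
  exact (norm_sum_le _ _).trans_eq (Finset.sum_congr rfl fun i _ => by rw [norm_mul, sq])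

/-- The Gaussian-weighted integrand whose integral computes the moments of `1 - |aᵀ a|²`. -/
noncomputable def momentWeight {d : ℕ} (k : ℕ) (z : Fin d → ℂ) : ℝ :=
  (normSqVec z ^ 2 - ‖z ⬝ᵥ z‖ ^ 2) ^ k * exp (-normSqVec z)

theorem continuous_momentWeight {d : ℕ} (k : ℕ) :
    Continuous (momentWeight k : (Fin d → ℂ) → ℝ) := by
  unfold momentWeight normSqVec dotProduct
  fun_prop

theorem normSqVec_smul {d : ℕ} (r : ℝ) (z : Fin d → ℂ) :
    normSqVec ((r : ℂ) • z) = r ^ 2 * normSqVec z := by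
  simp [normSqVec, mul_pow, Finset.mul_sum]

theorem momentWeight_smul_col {d : ℕ} (k : ℕ) (r : ℝ) (W : UGroup d) (j : Fin d) :
    momentWeight k ((r : ℂ) • (W : Matrix (Fin d) (Fin d) ℂ).col j) =
      (r ^ 2) ^ (2 * k) * exp (-r ^ 2) *
        (1 - ‖(W : Matrix (Fin d) (Fin d) ℂ).col j ⬝ᵥ
          (W : Matrix (Fin d) (Fin d) ℂ).col j‖ ^ 2) ^ k := by
  rw [momentWeight, normSqVec_smul, normSqVec_col, smul_dotProduct, dotProduct_smul, norm_smul,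
    norm_smul, Complex.norm_real, norm_eq_abs, ← mul_assoc, abs_mul_abs_self, mul_one,
    pow_mul (r ^ 2), mul_right_comm (((r ^ 2) ^ 2) ^ k), ← mul_pow]
  ring

/-- The moments of `1 - |aᵀ a|²` under Haar measure, as a ratio of Gaussian integrals. -/
theorem lintegral_momentWeight {d : ℕ} (k : ℕ) (j : Fin d) :
    ∫⁻ g : RealPair d, ENNReal.ofReal (momentWeight k (toComplexVec d g)) =
      (∫⁻ g : RealPair d, ENNReal.ofReal (‖g‖ ^ (2 * (2 * k)) * exp (-‖g‖ ^ 2))) *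
        ∫⁻ W, ENNReal.ofReal ((1 - ‖(W : Matrix (Fin d) (Fin d) ℂ).col j ⬝ᵥ
          (W : Matrix (Fin d) (Fin d) ℂ).col j‖ ^ 2) ^ k) ∂unitaryHaar d := by
  have hcont : Continuous fun p : UGroup d × RealPair d =>
      momentWeight k ((p.1 : Matrix (Fin d) (Fin d) ℂ) *ᵥ toComplexVec d p.2) :=
    (continuous_momentWeight k).comp ((continuous_subtype_val.comp continuous_fst).matrix_mulVec
      ((continuous_toComplexVec d).comp continuous_snd))
  have hW (W : UGroup d) : ∫⁻ g : RealPair d, ENNReal.ofReal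
      (momentWeight k ((W : Matrix (Fin d) (Fin d) ℂ) *ᵥ toComplexVec d g)) =
      ∫⁻ g : RealPair d, ENNReal.ofReal (momentWeight k (toComplexVec d g)) := by
    rw [← (LinearIsometryEquiv.measurePreserving (unitaryAct W)).lintegral_comp_emb
      (unitaryAct W).toMeasurableEquiv.measurableEmbedding
      (fun g => ENNReal.ofReal (momentWeight k (toComplexVec d g)))]
    simp_rw [toComplexVec_unitaryAct]
  have hg (g : RealPair d) : ∫⁻ W, ENNReal.ofReal
      (momentWeight k ((W : Matrix (Fin d) (Fin d) ℂ) *ᵥ toComplexVec d g)) ∂unitaryHaar d =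
      ENNReal.ofReal (‖g‖ ^ (2 * (2 * k)) * exp (-‖g‖ ^ 2)) *
        ∫⁻ W, ENNReal.ofReal ((1 - ‖(W : Matrix (Fin d) (Fin d) ℂ).col j ⬝ᵥ
          (W : Matrix (Fin d) (Fin d) ℂ).col j‖ ^ 2) ^ k) ∂unitaryHaar d := by
    -- Writing `z = ‖g‖ V e_j` gives `W z = ‖g‖ (W V) e_j`; right invariance then removes `V`, so
    -- only `‖g‖` matters.
    obtain ⟨V, hV⟩ := exists_unitary_col j (toComplexVec d g)
    rw [normSqVec_toComplexVec_eq_norm_sq, sqrt_sq (norm_nonneg _)] at hV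
    have (W : UGroup d) : (W : Matrix (Fin d) (Fin d) ℂ) *ᵥ toComplexVec d g =
        ((‖g‖ : ℝ) : ℂ) • ((W * V : UGroup d) : Matrix (Fin d) (Fin d) ℂ).col j := by
      rw [hV, mulVec_smul, ← mulVec_single_one, ← mulVec_single_one, mulVec_mulVec]
      rfl
    simp_rw [this]
    rw [lintegral_mul_right_eq_self (μ := unitaryHaar d) (fun W : UGroup d => ENNReal.ofReal
      (momentWeight k (((‖g‖ : ℝ) : ℂ) • (W : Matrix (Fin d) (Fin d) ℂ).col j))) V]
    simp_rw [momentWeight_smul_col]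
    rw [← lintegral_const_mul' _ _ ENNReal.ofReal_ne_top]
    refine lintegral_congr fun W => ?_
    rw [← ENNReal.ofReal_mul (by positivity), ← pow_mul]
  have hswap := lintegral_lintegral_swap (μ := unitaryHaar d) (ν := (volume : Measure (RealPair d)))
    (f := fun W g => ENNReal.ofReal
      (momentWeight k ((W : Matrix (Fin d) (Fin d) ℂ) *ᵥ toComplexVec d g)))
    (ENNReal.measurable_ofReal.comp hcont.measurable).aemeasurable
  simp_rw [hW, hg] at hswap
  rw [lintegral_const, measure_univ, mul_one] at hswap
  rw [hswap, lintegral_mul_const _ (by fun_prop)]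

end HaarUnitary

/-! ### Moment determinacy, Beta moments and the Gamma ratio -/

namespace HaarUnitary

open Real Set

/-- Two finite measures supported in `[0, 1]` with the same moments of `1 - x` are equal. -/
theorem measure_ext_of_integral_one_sub_pow {μ ν : Measure ℝ} [IsFiniteMeasure μ]
    [IsFiniteMeasure ν] (hμ : ∀ᵐ x ∂μ, x ∈ Icc (0 : ℝ) 1) (hν : ∀ᵐ x ∂ν, x ∈ Icc (0 : ℝ) 1)
    (h : ∀ k : ℕ, ∫ x, (1 - x) ^ k ∂μ = ∫ x, (1 - x) ^ k ∂ν) : μ = ν := by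
  have hint (ρ : Measure ℝ) [IsFiniteMeasure ρ] (hρ : ∀ᵐ x ∂ρ, x ∈ Icc (0 : ℝ) 1)
      (g : ℝ → ℝ) (hg : Continuous g) : Integrable g ρ := by
    obtain ⟨C, hC⟩ := isCompact_Icc.exists_bound_of_continuousOn (s := Icc (0 : ℝ) 1)
      hg.continuousOn
    exact Integrable.of_bound hg.aestronglyMeasurable C (hρ.mono fun x hx => hC x hx)
  have hpoly (p : Polynomial ℝ) : ∫ x, p.eval (1 - x) ∂μ = ∫ x, p.eval (1 - x) ∂ν := by
    induction p using Polynomial.induction_on' with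
    | add p q hp hq =>
      simp only [Polynomial.eval_add]
      rw [integral_add (hint μ hμ _ (by fun_prop)) (hint μ hμ _ (by fun_prop)),
        integral_add (hint ν hν _ (by fun_prop)) (hint ν hν _ (by fun_prop)), hp, hq]
    | monomial n a =>
      simp only [Polynomial.eval_monomial, integral_const_mul, h]
  refine ext_of_forall_integral_eq_of_IsFiniteMeasure fun f => ?_
  have hfint (ρ : Measure ℝ) [IsFiniteMeasure ρ] (hρ : ∀ᵐ x ∂ρ, x ∈ Icc (0 : ℝ) 1)
      {ε : ℝ} {p : Polynomial ℝ} (hp : ∀ x ∈ Icc (0 : ℝ) 1, |p.eval x - f (1 - x)| < ε) :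
      |∫ x, p.eval (1 - x) ∂ρ - ∫ x, f x ∂ρ| ≤ ε * ρ.real univ := by
    rw [← integral_sub (hint ρ hρ _ (by fun_prop)) (hint ρ hρ _ (by fun_prop)), ← norm_eq_abs]
    refine norm_integral_le_of_norm_le_const (hρ.mono fun x hx => ?_)
    have := hp (1 - x) ⟨by linarith [hx.2], by linarith [hx.1]⟩
    rw [sub_sub_cancel] at this
    exact this.le
  by_contra hne
  set δ := |∫ x, f x ∂μ - ∫ x, f x ∂ν| with hδ
  have hδ0 : 0 < δ := abs_pos.2 (sub_ne_zero.2 hne)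
  set S := μ.real univ + ν.real univ with hS
  have hS0 : 0 ≤ S := by positivity
  -- This tolerance makes the total error `δ S / (S + 1)`, strictly below `δ`, even when `S = 0`.
  obtain ⟨p, hp⟩ := exists_polynomial_near_of_continuousOn 0 1 (fun x => f (1 - x))
    (by fun_prop) (δ / (S + 1)) (by positivity)
  have h1 := hfint μ hμ hp
  have h2 := hfint ν hν hp
  rw [hpoly p] at h1
  have h3 : δ ≤ δ / (S + 1) * S := by
    rw [hS, mul_add, ← hS]
    have := abs_sub_le (∫ x, f x ∂ν) (∫ x, p.eval (1 - x) ∂ν) (∫ x, f x ∂μ)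
    rw [abs_sub_comm (∫ x, f x ∂ν), abs_sub_comm (∫ x, f x ∂ν)] at this
    linarith
  have h4 : δ / (S + 1) * S = δ - δ / (S + 1) := by field_simp; ring
  have : 0 < δ / (S + 1) := by positivity
  linarith

theorem ae_betaMeasure_mem_Icc (a b : ℝ) : ∀ᵐ x ∂betaMeasure a b, x ∈ Icc (0 : ℝ) 1 := by
  rw [betaMeasure, ae_withDensity_iff (by unfold betaPDF; fun_prop)]
  refine .of_forall fun x hx => ⟨?_, ?_⟩
  · by_contra! h
    exact hx (betaPDF_eq_zero_of_nonpos h.le)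
  · by_contra! h
    exact hx (betaPDF_eq_zero_of_one_le h.le)

/-- Multiplying the `Beta(1, b)` density by `(1 - x)^k` gives a multiple of the `Beta(1, b + k)`
density; the value is the ratio of normalising constants. -/
theorem integral_one_sub_pow_betaMeasure_one {b : ℝ} (hb : 0 < b) (k : ℕ) :
    ∫ x, (1 - x) ^ k ∂betaMeasure 1 b = b / (b + k) := by
  have hbk : 0 < b + k := by positivity
  have hpdf {c : ℝ} (hc : 0 < c) (x : ℝ) : 0 ≤ betaPDFReal 1 c x := by
    by_cases h : 0 < x ∧ x < 1
    · exact (betaPDFReal_pos h.1 h.2 one_pos hc).le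
    · simp [betaPDFReal, h]
  have hbeta {c : ℝ} (hc : 0 < c) : beta 1 c = 1 / c := by
    have := Gamma_pos_of_pos hc
    rw [beta, add_comm 1 c, Gamma_add_one hc.ne', Gamma_one]
    field_simp
  have hone {c : ℝ} (hc : 0 < c) : ∫ x, betaPDFReal 1 c x = 1 := by
    rw [integral_eq_lintegral_of_nonneg_ae (.of_forall (hpdf hc))
      (measurable_betaPDFReal _ _).aestronglyMeasurable]
    have := lintegral_betaPDF_eq_one one_pos hc
    simp only [betaPDF] at this
    rw [this, ENNReal.toReal_one]
  rw [betaMeasure, integral_withDensity_eq_integral_toReal_smul (by unfold betaPDF; fun_prop)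
    (.of_forall fun x => by simp [betaPDF])]
  have (x : ℝ) : (betaPDF 1 b x).toReal • (1 - x) ^ k =
      b / (b + k) * betaPDFReal 1 (b + k) x := by
    rw [betaPDF, ENNReal.toReal_ofReal (hpdf hb x), smul_eq_mul, betaPDFReal, betaPDFReal]
    split_ifs with h
    · have h1 : 0 < 1 - x := by linarith [h.2]
      rw [hbeta hb, hbeta hbk, add_sub_right_comm, rpow_add_natCast h1.ne']
      field_simp
    · simp
  simp_rw [this]
  rw [integral_const_mul, hone hbk, mul_one]

/-- The ratio of Gamma factors is `m / (m + k)` with `m = n / 2`, by the duplication formula. -/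
theorem gamma_ratio_eq {n : ℕ} [NeZero n] (k : ℕ) :
    4 ^ k * (√π ^ (n + 1) / Gamma ((n + 1) / 2) * Gamma ((n + 1) / 2 + k)) *
        (√π ^ (n + 1) / Gamma (n / 2) * Gamma (n / 2 + k)) =
      (n / 2 : ℝ) / (n / 2 + k) *
        (√π ^ (2 * (n + 1)) / Gamma (n + 1) * Gamma (n + 1 + 2 * k)) := by
  have hn : (0 : ℝ) < n := by exact_mod_cast NeZero.pos n
  have hg : 0 < Gamma (n : ℝ) := Gamma_pos_of_pos hn
  have hg1 : 0 < Gamma (n / 2 : ℝ) := Gamma_pos_of_pos (by positivity)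
  have hg2 : 0 < Gamma (n / 2 + 1 / 2 : ℝ) := Gamma_pos_of_pos (by positivity)
  have hπ : 0 < √π := by positivity
  have h1 := Gamma_mul_Gamma_add_half (n / 2 : ℝ)
  have h2 := Gamma_mul_Gamma_add_half (n / 2 + k : ℝ)
  have e1 : (2 : ℝ) * (n / 2) = n := by ring
  have e2 : (2 : ℝ) * (n / 2 + k) = n + 2 * k := by ring
  have e3 : (n / 2 + k + 1 / 2 : ℝ) = (n + 1) / 2 + k := by ring
  have e4 : (n / 2 + 1 / 2 : ℝ) = (n + 1) / 2 := by ring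
  have e5 : (n + 1 + 2 * k : ℝ) = (n + 2 * k) + 1 := by ring
  -- The factor `4 ^ k` from the Gram identity cancels the discrepancy between the two duplication
  -- formulas.
  have e6 : (2 : ℝ) ^ (1 - (n + 2 * k) : ℝ) * 4 ^ k = 2 ^ (1 - n : ℝ) := by
    rw [show (4 : ℝ) ^ k = 2 ^ ((2 * k : ℕ) : ℝ) by rw [rpow_natCast, pow_mul]; norm_num,
      ← rpow_add two_pos]
    congr 1
    push_cast
    ring
  rw [e1, e4] at h1
  rw [e2, e3] at h2
  rw [e4] at hg2
  rw [e5, Gamma_add_one (s := (n : ℝ) + 2 * k) (by positivity), Gamma_add_one hn.ne']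
  set A := Gamma (n / 2 : ℝ)
  set B := Gamma ((n + 1) / 2 : ℝ)
  set C := Gamma (n / 2 + k : ℝ)
  set D := Gamma ((n + 1) / 2 + k : ℝ)
  set P := (2 : ℝ) ^ (1 - n : ℝ)
  have hP : 0 < P := by positivity
  calc _ = 4 ^ k * (√π ^ (n + 1)) ^ 2 * (C * D) / (A * B) := by field_simp
    _ = _ := by
      rw [h1, h2, mul_comm 2 (n + 1), pow_mul, ← e6]
      field_simp

end HaarUnitary

/-! ### Haar moments and the Beta law -/

namespace HaarUnitary

open Real Matrix

theorem lintegral_one_sub_norm_dotProduct_col_pow {n : ℕ} [NeZero n] (k : ℕ) (j : Fin (n + 1)) :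
    ∫⁻ W, ENNReal.ofReal ((1 - ‖(W : Matrix (Fin (n + 1)) (Fin (n + 1)) ℂ).col j ⬝ᵥ
      (W : Matrix (Fin (n + 1)) (Fin (n + 1)) ℂ).col j‖ ^ 2) ^ k) ∂unitaryHaar (n + 1) =
      ENNReal.ofReal ((n / 2 : ℝ) / (n / 2 + k)) := by
  have h1 := lintegral_momentWeight k j
  have hrank : Module.finrank ℝ (RealPair (n + 1)) = 2 * (n + 1) := by
    rw [(WithLp.linearEquiv 2 ℝ _).finrank_eq, Module.finrank_prod, finrank_euclideanSpace_fin]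
    ring
  have : Nontrivial (RealPair (n + 1)) :=
    Module.nontrivial_of_finrank_pos (R := ℝ) (by rw [hrank]; omega)
  have hn : (0 : ℝ) < n := by exact_mod_cast NeZero.pos n
  have h2 : ∫⁻ g : RealPair (n + 1), ENNReal.ofReal (momentWeight k (toComplexVec (n + 1) g)) =
      ENNReal.ofReal (4 ^ k * (√π ^ (n + 1) / Gamma ((n + 1) / 2) * Gamma ((n + 1) / 2 + k)) *
        (√π ^ (n + 1) / Gamma (n / 2) * Gamma (n / 2 + k))) := by
    rw [← lintegral_lintegral_gram_pow k, ← (WithLp.volume_preserving_toLp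
      (EuclideanSpace ℝ (Fin (n + 1))) (EuclideanSpace ℝ (Fin (n + 1)))).lintegral_comp_emb
      (MeasurableEquiv.toLp 2 _).measurableEmbedding, Measure.volume_eq_prod, lintegral_prod]
    · refine lintegral_congr fun x => lintegral_congr fun y => ?_
      rw [momentWeight, norm_dotProduct_toComplexVec_sq, normSqVec_toComplexVec]
      rfl
    · have := (continuous_momentWeight k).comp (continuous_toComplexVec (n + 1))
      exact ((ENNReal.measurable_ofReal.comp this.measurable).comp
        (MeasurableEquiv.toLp 2 _).measurable).aemeasurable
  rw [h2, gamma_ratio_eq, lintegral_norm_pow_mul_exp_neg_norm_sq, hrank] at h1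
  have e : ((2 * (n + 1) : ℕ) : ℝ) / 2 = n + 1 := by push_cast; ring
  have hc : 0 < √π ^ (2 * (n + 1)) / Gamma (n + 1) * Gamma (n + 1 + 2 * k : ℝ) := by
    have := Gamma_pos_of_pos (s := (n : ℝ) + 1) (by positivity)
    have := Gamma_pos_of_pos (s := (n : ℝ) + 1 + 2 * k) (by positivity)
    positivity
  rw [e, Nat.cast_mul, Nat.cast_ofNat, mul_comm, ENNReal.ofReal_mul hc.le] at h1
  -- The radial moment is positive and finite, so it cancels in `ENNReal`.
  exact ((ENNReal.mul_right_inj (by simpa using hc) ENNReal.ofReal_ne_top).1 h1).symm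

theorem hasLaw_norm_dotProduct_col_sq {d : ℕ} (hd : 2 ≤ d) (j : Fin d) :
    HasLaw (fun W : UGroup d => ‖(W : Matrix (Fin d) (Fin d) ℂ).col j ⬝ᵥ
      (W : Matrix (Fin d) (Fin d) ℂ).col j‖ ^ 2)
      (betaMeasure 1 (((d : ℝ) - 1) / 2)) (unitaryHaar d) := by
  obtain ⟨n, rfl⟩ : ∃ n, d = n + 1 := ⟨d - 1, by omega⟩
  have : NeZero n := ⟨by omega⟩
  have hn : (0 : ℝ) < n := by exact_mod_cast NeZero.pos n
  have hcont : Continuous fun W : UGroup (n + 1) =>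
      ‖(W : Matrix (Fin (n + 1)) (Fin (n + 1)) ℂ).col j ⬝ᵥ
        (W : Matrix (Fin (n + 1)) (Fin (n + 1)) ℂ).col j‖ ^ 2 := by
    have (i : Fin (n + 1)) : Continuous fun W : UGroup (n + 1) =>
        (W : Matrix (Fin (n + 1)) (Fin (n + 1)) ℂ) i j :=
      continuous_subtype_val.matrix_elem i j
    exact (continuous_finsetSum _ fun i _ => (this i).mul (this i)).norm.pow 2
  refine ⟨hcont.measurable.aemeasurable, ?_⟩
  push_cast
  rw [add_sub_cancel_right]
  have hprob := isProbabilityMeasureBeta one_pos (half_pos hn)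
  have : IsProbabilityMeasure ((unitaryHaar (n + 1)).map _) :=
    Measure.isProbabilityMeasure_map hcont.measurable.aemeasurable
  refine measure_ext_of_integral_one_sub_pow ?_ (ae_betaMeasure_mem_Icc _ _) fun k => ?_
  · refine (ae_map_iff (p := (· ∈ Set.Icc (0 : ℝ) 1)) hcont.measurable.aemeasurable
      measurableSet_Icc).2 (.of_forall fun W => ⟨by positivity, norm_dotProduct_col_sq_le_one W j⟩)
  · rw [integral_one_sub_pow_betaMeasure_one (half_pos hn),
      integral_map hcont.measurable.aemeasurable (by fun_prop),
      integral_eq_lintegral_of_nonneg_ae (.of_forall fun W =>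
        pow_nonneg (sub_nonneg.2 (norm_dotProduct_col_sq_le_one W j)) k)
        (((continuous_const.sub hcont).pow k).measurable.aestronglyMeasurable),
      lintegral_one_sub_norm_dotProduct_col_pow, ENNReal.toReal_ofReal (by positivity)]

end HaarUnitary

/-- If `U` is a Haar random unitary `d × d` matrix, `d ≥ 2`, and `a` is its `j`-th column, then
`|aᵀ a|² ~ Beta(1, (d - 1) / 2)`. -/
theorem mainTheorem5 {Ω : Type*} [MeasurableSpace Ω] (P : Measure Ω) (d : ℕ) (hd : 2 ≤ d)
    (U : Ω → HaarUnitary.UGroup d) (hU : HasLaw U (HaarUnitary.unitaryHaar d) P)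
    (j : Fin d) :
    HasLaw
      (fun ω => ‖(U ω : Matrix (Fin d) (Fin d) ℂ).col j ⬝ᵥ
        (U ω : Matrix (Fin d) (Fin d) ℂ).col j‖ ^ 2)
      (betaMeasure 1 (((d : ℝ) - 1) / 2)) P := by
  exact (HaarUnitary.hasLaw_norm_dotProduct_col_sq hd j).fun_comp hU
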